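/- Let $k\ge 3$ and let $0<n_1<n_2<\cdots<n_k$ be integers with $\gcd(n_1,\dots,n_k)=1$ (they generate the numerical semigroup $S=\langle n_1,\dots,n_k\rangle$, but need not do so minimally). For $n\in\mathbb N$, a factorization of $n$ is a tuple $(a_1,\dots,a_k)\in\mathbb N^k$ with $a_1n_1+\cdots+a_kn_k=n$, its length is $a_1+\cdots+a_k$, and $\mathsf L[\![n]\!]$ denotes the multiset containing one copy of the length of each factorization of $n$; $|\mathsf L[\![n]\!]|$ is its cardinality counted with multiplicity. Define $F:\mathbb R\to\mathbb R$ by $$F(x)=\frac{(k-1)\,n_1n_2\cdots n_k}{2}\sum_{r=1}^k\frac{|1-n_rx|\,(1-n_rx)^{k-3}}{\prod_{j\ne r}(n_j-n_r)} .$$ Then $F$ is a probability density function whose support is $\left[\frac1{n_k},\frac1{n_1}\right]$, and the following hold. (a) For all real $\alpha<\beta$, $$\lim_{n\to\infty}\frac{|\{\ell\in\mathsf L[\![n]\!]:\ell\in[\alpha n,\beta n]\}|}{|\mathsf L[\![n]\!]|}=\int_\alpha^\beta F(t)\,dt,$$ where the elements in the numerator are counted with multiplicity. (b) For every $p\in\mathbb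 N=\{0,1,2,\dots\}$, the $p$th moment of $F$ is $$\int_0^1t^pF(t)\,dt=\binom{p+k-1}{p}^{-1}h_p\!\left(\frac1{n_1},\dots,\frac1{n_k}\right),$$ where $h_p$ is the complete homogeneous symmetric polynomial of degree $p$ in $k$ variables. (c) For every complex-valued function $g$ that is continuous on $\left[\frac1{n_k},\frac1{n_1}\right]$ (in particular, if $n_1\ge2$, for every continuous $g:(0,1)\to\mathbb C$), $$\lim_{n\to\infty}\frac1{|\mathsf L[\![n]\!]|}\sum_{\ell\in\mathsf L[\![n]\!]}g\!\left(\frac{\ell}{n}\right)=\int_0^1g(t)F(t)\,dt ;$$ here the values of $g$ outside $\left[\frac1{n_k},\frac1{n_1}\right]$ are irrelevant, since $F$ vanishes there and $\ell/n\in\left[\frac1{n_k},\frac1{n_1}\right]$ for all $\ell\in\mathsf L[\![n]\!]$, $n\ge1$. -/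

import Mathlib

open Filter Topology

/-- The factorizations of `n` over the generators `gen 0, …, gen (k-1)`: all tuples `a ∈ ℕᵏ` with
`∑ aᵢ · gen i = n`. The bound `aᵢ ≤ n` only serves to produce a `Finset`; it is automatic
when the generators are positive, see `mem_factorizations`. -/
def factorizations {k : ℕ} (gen : Fin k → ℕ) (n : ℕ) : Finset (Fin k → ℕ) :=
  (Fintype.piFinset fun _ => Finset.range (n + 1)).filter fun a => ∑ i, a i * gen i = n

theorem mem_factorizations {k : ℕ} {gen : Fin k → ℕ} (hpos : ∀ i, 0 < gen i) (n : ℕ)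
    (a : Fin k → ℕ) : a ∈ factorizations gen n ↔ ∑ i, a i * gen i = n := by
  simp only [factorizations, Finset.mem_filter, Fintype.mem_piFinset, Finset.mem_range,
    and_iff_right_iff_imp]
  intro h i
  have h1 : a i * gen i ≤ ∑ j, a j * gen j :=
    Finset.single_le_sum (f := fun j => a j * gen j) (fun _ _ => Nat.zero_le _)
      (Finset.mem_univ i)
  have h2 : a i ≤ a i * gen i := Nat.le_mul_of_pos_right _ (hpos i)
  omega

/-- The length multiset `L⟦n⟧`: one copy of the length `∑ aᵢ` for each factorization `a` of `n`. -/
def lengthMultiset {k : ℕ} (gen : Fin k → ℕ) (n : ℕ) : Multiset ℕ :=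
  (factorizations gen n).val.map fun a => ∑ i, a i

/-- The limiting length density
`F(x) = ((k-1) n₁⋯n_k / 2) ∑ᵣ |1 - nᵣ x| (1 - nᵣ x)^(k-3) / ∏_{j ≠ r} (nⱼ - nᵣ)`, for `k ≥ 3`. -/
noncomputable def lengthDensity {k : ℕ} (gen : Fin k → ℕ) (x : ℝ) : ℝ :=
  ((k : ℝ) - 1) * (∏ i, (gen i : ℝ)) / 2 *
    ∑ r, |1 - (gen r : ℝ) * x| * (1 - (gen r : ℝ) * x) ^ (k - 3) /
      ∏ j ∈ Finset.univ.erase r, ((gen j : ℝ) - (gen r : ℝ))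

/-!
The factorization lengths are treated by the method of moments.

Let `w e a = ∏ i, (a i + e i).choose (e i)`. The sum of `w e a` over the factorizations `a` of `n`
is the `n`-th coefficient of `∏ i, (1 - X ^ nᵢ)⁻¹ ^ (e i + 1)`. With `L = ∏ nᵢ` and
`D + 1 = ∑ i, (e i + 1)` this series is `Q / (1 - X ^ L) ^ (D + 1)` for a polynomial `Q` such that
`(1 - X ^ nᵢ) Q` is divisible by `1 - X ^ L` for all `i`. So the sums of the coefficients of `Q` over
residue classes modulo `L` are invariant under translation by each `nᵢ`, and thus all equal as
the `nᵢ` have no common factor (`residueSum_eq_div`). This gives the leading term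
`n ^ D / (D! ∏ nᵢ ^ (e i + 1))` of the coefficients (`tendsto_sum_prod_choose`). By Vandermonde,
the sum of `w e a` over all `e` with `∑ e i = p` is `(ℓ + k - 1 + p).choose p`, where `ℓ` is the
length of `a`, and this is `ℓ ^ p / p!` to leading order. Hence the `p`-th moment of `ℓ / n` tends to
`h_p(1/n₁, …, 1/n_k) / (p + k - 1).choose p` (`tendsto_mean_length_pow`).

On the other side, divided differences of order `k - 1` kill the powers `(1 - nᵣ x) ^ (k - 2)`, so
the density is a B-spline, a combination of the truncated powers `max (1 - nᵣ x) 0 ^ (k - 2)`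
(`lengthDensity_eq`). Its moments are beta integrals, and the partial fraction decomposition of
`∏ (1 - X / nᵢ)⁻¹` (`eval_hsymm_inv`) shows that they are the limits above.

Since all `ℓ / n` lie in `[1/n_k, 1/n₁] ⊆ [0, 1]`, Weierstrass approximation upgrades the
convergence of moments to that of averages of continuous functions (`tendsto_lengthMean`). The
density is then nonnegative because limits of averages of nonnegative functions are, and the
distribution of lengths follows by squeezing an indicator between trapezoids. Finally, the support
is the whole interval since at most `k - 1` of the powers `(1 - nᵣ x) ^ (k - 2)`, any `k - 1` of
which are linearly independent, contribute at any point of its interior (`tsupport_lengthDensity`).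
-/

/-! ### Generating functions of weighted factorization counts -/

/-- The power series `∑ a, c a * X ^ (m * a)`. -/
noncomputable def spreadSeries (m : ℕ) (c : ℕ → ℝ) : PowerSeries ℝ :=
  PowerSeries.mk fun j => if m ∣ j then c (j / m) else 0

theorem coeff_prod_spreadSeries {k : ℕ} {gen : Fin k → ℕ} (hpos : ∀ i, 0 < gen i)
    (c : Fin k → ℕ → ℝ) (n : ℕ) :
    PowerSeries.coeff n (∏ i, spreadSeries (gen i) (c i)) =
      ∑ a ∈ factorizations gen n, ∏ i, c i (a i) := by
  rw [PowerSeries.coeff_prod]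
  symm
  refine Finset.sum_of_injOn (fun a => Finsupp.equivFunOnFinite.symm fun i => a i * gen i)
    ?_ ?_ ?_ ?_
  · intro a _ b _ hab
    funext i
    have := DFunLike.congr_fun hab i
    exact Nat.eq_of_mul_eq_mul_right (hpos i) (by simpa using this)
  · intro a ha
    have ha' := (mem_factorizations hpos n a).1 ha
    simpa [Finset.mem_finsuppAntidiag] using ha'
  · intro l hl hl'
    by_contra hne
    have hdvd : ∀ i, gen i ∣ l i := by
      intro i
      by_contra hi
      exact hne (Finset.prod_eq_zero (Finset.mem_univ i) (by simp [spreadSeries, hi]))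
    refine hl' ⟨fun i => l i / gen i, ?_, ?_⟩
    · rw [Finset.mem_coe, mem_factorizations hpos]
      simp only [Nat.div_mul_cancel (hdvd _)]
      exact (Finset.mem_finsuppAntidiag.1 hl).1
    · ext i
      simp [Nat.div_mul_cancel (hdvd i)]
  · intro a _
    refine Finset.prod_congr rfl fun i _ => ?_
    simp [spreadSeries, Nat.mul_div_cancel _ (hpos i)]

/-- The power series `(1 - X ^ m)⁻¹ ^ (d + 1)`. -/
noncomputable def negBinomialSeries (m d : ℕ) : PowerSeries ℝ :=
  spreadSeries m fun a => ((d + a).choose d : ℝ)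

theorem one_sub_pow_mul_negBinomialSeries {m : ℕ} (hm : 0 < m) (d : ℕ) :
    (1 - PowerSeries.X ^ m) ^ (d + 1) * negBinomialSeries m d = 1 := by
  have h : negBinomialSeries m d = PowerSeries.expand m hm.ne'
      (PowerSeries.mk fun n => (Nat.choose (d + n) d : ℝ)) := by
    ext n
    rw [PowerSeries.coeff_expand]
    simp [negBinomialSeries, spreadSeries]
  rw [h, ← PowerSeries.expand_X m hm.ne', ← map_one (PowerSeries.expand m hm.ne'), ← map_sub,
    ← map_pow, ← map_mul, mul_comm, PowerSeries.mk_add_choose_mul_one_sub_pow_eq_one]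

/-- Vandermonde's identity with negative exponents, in the form of a product of powers of
`(1 - X)⁻¹`. -/
theorem sum_prod_choose {k : ℕ} (hk : 1 ≤ k) (a : Fin k → ℕ) (p : ℕ) :
    ∑ e ∈ factorizations (fun _ : Fin k => 1) p, ∏ i, ((a i + e i).choose (e i) : ℝ) =
      ((∑ i, a i + (k - 1) + p).choose p : ℝ) := by
  have h1 : ∏ i, negBinomialSeries 1 (a i) = negBinomialSeries 1 (∑ i, a i + (k - 1)) := by
    have hl : (1 - PowerSeries.X ^ 1 : PowerSeries ℝ) ^ (∑ i, a i + (k - 1) + 1) *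
        ∏ i, negBinomialSeries 1 (a i) = 1 := by
      have : ∑ i, a i + (k - 1) + 1 = ∑ i, (a i + 1) := by
        rw [Finset.sum_add_distrib]; simp; omega
      rw [this, ← Finset.prod_pow_eq_pow_sum, ← Finset.prod_mul_distrib]
      exact Finset.prod_eq_one fun i _ => one_sub_pow_mul_negBinomialSeries one_pos _
    have hr := one_sub_pow_mul_negBinomialSeries one_pos (∑ i, a i + (k - 1))
    exact (left_inv_eq_right_inv (by rwa [mul_comm] at hr) hl).symm
  have h2 := congrArg (PowerSeries.coeff p) h1
  simp only [negBinomialSeries] at h2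
  rw [coeff_prod_spreadSeries (fun _ => one_pos)] at h2
  simp only [spreadSeries, PowerSeries.coeff_mk, one_dvd, if_true, Nat.div_one] at h2
  rw [Nat.choose_symm_add] at h2
  rw [← h2]
  refine Finset.sum_congr rfl fun e _ => Finset.prod_congr rfl fun i _ => ?_
  rw [Nat.choose_symm_add]

theorem eval_hsymm_eq_sum {k : ℕ} (y : Fin k → ℝ) (p : ℕ) :
    MvPolynomial.eval y (MvPolynomial.hsymm (Fin k) ℝ p) =
      ∑ e ∈ factorizations (fun _ : Fin k => 1) p, ∏ i, y i ^ e i := by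
  rw [MvPolynomial.hsymm, map_sum]
  refine Finset.sum_bij' (fun s _ i => s.1.count i)
    (fun e he => (Sym.equivNatSumOfFintype (Fin k) p).symm
      ⟨e, by simpa using (mem_factorizations (fun _ => one_pos) p e).1 he⟩) ?_ ?_ ?_ ?_ ?_
  · intro s _
    rw [mem_factorizations fun _ => one_pos]
    simp
  · simp
  · intro s _
    rw [Equiv.symm_apply_eq]
    ext i
    simp
  · intro e he
    funext i
    have h := Sym.coe_equivNatSumOfFintype_apply_apply _ _ ((Sym.equivNatSumOfFintype (Fin k) p).symm
      ⟨e, by simpa using (mem_factorizations (fun _ => one_pos) p e).1 he⟩) i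
    rw [Equiv.apply_symm_apply] at h
    exact h.symm
  · intro s _
    rw [map_multiset_prod, Multiset.map_map, Finset.prod_multiset_map_count]
    simp only [Function.comp, MvPolynomial.eval_X]
    refine Finset.prod_subset (Finset.subset_univ _) fun i _ hi => ?_
    rw [Multiset.count_eq_zero_of_notMem (by simpa using hi), pow_zero]

theorem eval_hsymm_eq_coeff {k : ℕ} (y : Fin k → ℝ) (p : ℕ) :
    MvPolynomial.eval y (MvPolynomial.hsymm (Fin k) ℝ p) =
      PowerSeries.coeff p (∏ i, PowerSeries.mk fun n => y i ^ n) := by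
  rw [eval_hsymm_eq_sum, ← coeff_prod_spreadSeries fun _ => one_pos]
  simp [spreadSeries]

/-! ### Equidistribution of coefficients in residue classes -/

/-- The sum of the coefficients of a polynomial at the exponents congruent to `c` modulo `L`. -/
noncomputable def residueSum (L : ℕ) (c : ZMod L) : Polynomial ℝ →ₗ[ℝ] ℝ :=
  Polynomial.lsum fun j => if (j : ZMod L) = c then LinearMap.id else 0

theorem residueSum_eq_sum_range {L : ℕ} (c : ZMod L) (Q : Polynomial ℝ) :
    residueSum L c Q =
      ∑ j ∈ Finset.range (Q.natDegree + 1), if (j : ZMod L) = c then Q.coeff j else 0 := by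
  rw [residueSum, Polynomial.lsum_apply, Polynomial.sum_over_range _ (by simp)]
  refine Finset.sum_congr rfl fun j _ => ?_
  split_ifs <;> simp

theorem residueSum_X_pow_mul {L : ℕ} (c : ZMod L) (m : ℕ) (Q : Polynomial ℝ) :
    residueSum L c (Polynomial.X ^ m * Q) = residueSum L (c - m) Q := by
  induction Q using Polynomial.induction_on' with
  | add p q hp hq => rw [mul_add, map_add, map_add, hp, hq]
  | monomial n a =>
    rw [Polynomial.X_pow_mul_monomial]
    simp only [residueSum, Polynomial.lsum_apply]
    rw [Polynomial.sum_monomial_index _ _ (by simp), Polynomial.sum_monomial_index _ _ (by simp)]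
    simp [eq_sub_iff_add_eq]

theorem sum_residueSum {L : ℕ} [NeZero L] (Q : Polynomial ℝ) :
    ∑ c, residueSum L c Q = Q.eval 1 := by
  simp only [residueSum_eq_sum_range]
  rw [Finset.sum_comm, Polynomial.eval_eq_sum_range]
  simp

/-- If `Q` is divisible by `(X ^ L - 1) / (X ^ m - 1)` for each `m` in a family of generators
without common factor, then the coefficients of `Q` are equidistributed modulo `L`: the residue
sums are invariant under translation by each generator, hence by everything. -/
theorem residueSum_eq_div {k L : ℕ} [NeZero L] {gen : Fin k → ℕ}
    (hgcd : Finset.univ.gcd gen = 1) (Q : Polynomial ℝ)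
    (hQ : ∀ i, ∃ R, (1 - Polynomial.X ^ gen i) * Q = (1 - Polynomial.X ^ L) * R) (c : ZMod L) :
    residueSum L c Q = Q.eval 1 / L := by
  let H : AddSubgroup ℤ :=
    { carrier := {m | ∀ c : ZMod L, residueSum L (c + m) Q = residueSum L c Q}
      add_mem' := by
        intro a b ha hb c
        have := hb (c + a)
        push_cast
        rw [← add_assoc, this, ha]
      zero_mem' := by simp
      neg_mem' := by
        intro a ha c
        rw [← ha]
        simp }
  have hgen : ∀ i, (gen i : ℤ) ∈ H := by
    intro i c
    obtain ⟨R, hR⟩ := hQ i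
    have h := congrArg (residueSum L (c + gen i)) hR
    rw [sub_mul, sub_mul, one_mul, one_mul, map_sub, map_sub, residueSum_X_pow_mul,
      residueSum_X_pow_mul] at h
    simp only [CharP.cast_eq_zero, sub_zero, sub_self, add_sub_cancel_right] at h
    push_cast
    linarith
  have hone : (1 : ℤ) ∈ H := by
    obtain ⟨g, hg⟩ := Int.subgroup_cyclic H
    have hdvd : ∀ i, g.natAbs ∣ gen i := by
      intro i
      have := hgen i
      rw [hg, AddSubgroup.mem_closure_singleton] at this
      obtain ⟨t, ht⟩ := this
      have : g ∣ (gen i : ℤ) := ⟨t, by rw [← ht, smul_eq_mul, mul_comm]⟩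
      exact Int.natAbs_dvd_natAbs.2 this
    have h1 : g.natAbs ∣ 1 := hgcd ▸ Finset.dvd_gcd fun i _ => hdvd i
    rw [hg, AddSubgroup.mem_closure_singleton]
    rcases Int.natAbs_eq_iff.1 (Nat.dvd_one.1 h1) with h | h
    · exact ⟨1, by simp [h]⟩
    · exact ⟨-1, by simp [h]⟩
  have hall : ∀ c : ZMod L, residueSum L c Q = residueSum L 0 Q := by
    intro c
    have h : ((c.val : ℕ) : ℤ) ∈ H := by
      simpa using H.zsmul_mem hone c.val
    simpa using h 0
  have hsum := sum_residueSum (L := L) Q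
  simp only [hall] at hsum ⊢
  rw [Finset.sum_const, Finset.card_univ, ZMod.card, nsmul_eq_mul] at hsum
  rw [← hsum, mul_div_cancel_left₀]
  exact_mod_cast NeZero.ne L

/-! ### Asymptotics of weighted factorization counts -/

/-- Neither the truncated subtraction of a fixed `j` nor the floor in the division by `L` affects
the leading term. -/
theorem tendsto_choose_div_pow {L : ℕ} (hL : 0 < L) (j D : ℕ) :
    Tendsto (fun n : ℕ => ((D + (n - j) / L).choose D : ℝ) / (n : ℝ) ^ D) atTop
      (𝓝 (1 / (L ^ D * D.factorial))) := by
  have hL' : (0 : ℝ) < L := by exact_mod_cast hL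
  set M : ℕ → ℕ := fun n => D + (n - j) / L with hM
  have hMtop : Tendsto M atTop atTop :=
    tendsto_atTop_mono (fun _ => Nat.le_add_left _ _)
      ((Nat.tendsto_div_const_atTop hL.ne').comp (tendsto_sub_atTop_nat j))
  have hratio : Tendsto (fun n : ℕ => (M n : ℝ) / n) atTop (𝓝 (1 / L)) := by
    have hlo : Tendsto (fun n : ℕ => (1 : ℝ) / L - (j + 1) / n) atTop (𝓝 (1 / L)) := by
      simpa using tendsto_const_nhds.sub
        (tendsto_const_div_atTop_nhds_zero_nat ((j : ℝ) + 1))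
    have hhi : Tendsto (fun n : ℕ => (1 : ℝ) / L + D / n) atTop (𝓝 (1 / L)) := by
      simpa using tendsto_const_nhds.add (tendsto_const_div_atTop_nhds_zero_nat (D : ℝ))
    refine tendsto_of_tendsto_of_tendsto_of_le_of_le' hlo hhi ?_ ?_
    · filter_upwards [eventually_ge_atTop (j + 1)] with n hn
      have hn0 : (0 : ℝ) < n := by exact_mod_cast (by omega : 0 < n)
      have h1 : ((n : ℝ) - j) / L ≤ ((n - j) / L : ℕ) + 1 := by
        rw [div_le_iff₀ hL', ← Nat.cast_sub (by omega)]
        have := Nat.lt_div_mul_add hL (a := n - j)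
        have : n - j ≤ ((n - j) / L + 1) * L := by linarith
        exact_mod_cast this
      have h2 : (j : ℝ) / L ≤ j := div_le_self (by positivity) (by exact_mod_cast hL)
      rw [le_div_iff₀ hn0, sub_mul, div_mul_cancel₀ _ hn0.ne']
      rw [sub_div] at h1
      have h3 : (0 : ℝ) ≤ D := by positivity
      have h4 : 1 / (L : ℝ) * n = n / L := by ring
      simp only [hM]
      push_cast
      linarith
    · filter_upwards [eventually_ge_atTop 1] with n hn
      have hn0 : (0 : ℝ) < n := by exact_mod_cast hn
      have h1 : (((n - j) / L : ℕ) : ℝ) ≤ n / L :=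
        Nat.cast_div_le.trans (by gcongr; omega)
      rw [div_le_iff₀ hn0, add_mul, div_mul_cancel₀ _ hn0.ne']
      simp only [hM]
      push_cast
      have h4 : 1 / (L : ℝ) * n = n / L := by ring
      linarith
  have hE := ((isEquivalent_choose D).comp_tendsto hMtop)
  have hE' := hE.div (Asymptotics.IsEquivalent.refl (u := fun n : ℕ => (n : ℝ) ^ D))
  refine (Asymptotics.IsEquivalent.tendsto_nhds_iff hE').2 ?_
  have := (hratio.pow D).div_const (D.factorial : ℝ)
  convert this using 2 with n
  · simp only [Pi.div_apply, Function.comp]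
    rw [div_pow, div_right_comm]
  · rw [div_pow, one_pow, div_div]

/-- The cofactor `(1 - X ^ L) / (1 - X ^ m)` when `m ∣ L`. -/
noncomputable def geomCofactor (m L : ℕ) : Polynomial ℝ :=
  ∑ r ∈ Finset.range (L / m), (Polynomial.X ^ m) ^ r

theorem one_sub_mul_geomCofactor {m L : ℕ} (h : m ∣ L) :
    (1 - Polynomial.X ^ m) * geomCofactor m L = 1 - Polynomial.X ^ L := by
  rw [geomCofactor, mul_neg_geom_sum, ← pow_mul, Nat.mul_div_cancel' h]

theorem eval_one_geomCofactor (m L : ℕ) : (geomCofactor m L).eval 1 = (L / m : ℕ) := by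
  simp [geomCofactor, Polynomial.eval_finsetSum]

theorem prod_negBinomialSeries {k L : ℕ} (hL : 0 < L) {gen : Fin k → ℕ} (hpos : ∀ i, 0 < gen i)
    (hdvd : ∀ i, gen i ∣ L) (e : Fin k → ℕ) {D : ℕ} (hD : ∑ i, (e i + 1) = D + 1) :
    ∏ i, negBinomialSeries (gen i) (e i) =
      ((∏ i, geomCofactor (gen i) L ^ (e i + 1) : Polynomial ℝ) : PowerSeries ℝ) *
        negBinomialSeries L D := by
  have hl : (∏ i, (1 - PowerSeries.X ^ gen i : PowerSeries ℝ) ^ (e i + 1)) *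
      ∏ i, negBinomialSeries (gen i) (e i) = 1 := by
    rw [← Finset.prod_mul_distrib]
    exact Finset.prod_eq_one fun i _ => one_sub_pow_mul_negBinomialSeries (hpos i) _
  have hr : (∏ i, (1 - PowerSeries.X ^ gen i : PowerSeries ℝ) ^ (e i + 1)) *
      (((∏ i, geomCofactor (gen i) L ^ (e i + 1) : Polynomial ℝ) : PowerSeries ℝ) *
        negBinomialSeries L D) = 1 := by
    have : (∏ i, (1 - PowerSeries.X ^ gen i : PowerSeries ℝ) ^ (e i + 1)) *
        ((∏ i, geomCofactor (gen i) L ^ (e i + 1) : Polynomial ℝ) : PowerSeries ℝ) =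
        (1 - PowerSeries.X ^ L) ^ (D + 1) := by
      rw [← hD, ← Finset.prod_pow_eq_pow_sum, ← Polynomial.coeToPowerSeries.ringHom_apply, map_prod,
        ← Finset.prod_mul_distrib]
      refine Finset.prod_congr rfl fun i _ => ?_
      rw [map_pow, ← mul_pow]
      congr 1
      have := congrArg (Polynomial.coeToPowerSeries.ringHom (R := ℝ))
        (one_sub_mul_geomCofactor (hdvd i))
      simpa using this
    rw [← mul_assoc, this, one_sub_pow_mul_negBinomialSeries hL]
  rw [mul_comm] at hl
  exact left_inv_eq_right_inv hl hr

/-- Schur's asymptotic formula, for factorizations weighted by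
`∏ i, (a i + e i).choose (e i)`; equivalently, for the number of factorizations over the family in
which the `i`-th generator is repeated `e i + 1` times. -/
theorem tendsto_sum_prod_choose {k : ℕ} {gen : Fin k → ℕ} (hpos : ∀ i, 0 < gen i)
    (hgcd : Finset.univ.gcd gen = 1) (e : Fin k → ℕ) {D : ℕ} (hD : ∑ i, (e i + 1) = D + 1) :
    Tendsto (fun n : ℕ =>
        (∑ a ∈ factorizations gen n, ∏ i, ((a i + e i).choose (e i) : ℝ)) / (n : ℝ) ^ D) atTop
      (𝓝 (1 / (D.factorial * ∏ i, (gen i : ℝ) ^ (e i + 1)))) := by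
  set L : ℕ := ∏ i, gen i with hLdef
  have hL : 0 < L := Finset.prod_pos fun i _ => hpos i
  have : NeZero L := ⟨hL.ne'⟩
  have hdvd : ∀ i, gen i ∣ L := fun i => Finset.dvd_prod_of_mem _ (Finset.mem_univ i)
  set Q : Polynomial ℝ := ∏ i, geomCofactor (gen i) L ^ (e i + 1) with hQdef
  have hQ : ∀ c : ZMod L, residueSum L c Q = Q.eval 1 / L := by
    refine residueSum_eq_div hgcd Q fun i => ?_
    refine ⟨geomCofactor (gen i) L ^ (e i) *
      ∏ j ∈ Finset.univ.erase i, geomCofactor (gen j) L ^ (e j + 1), ?_⟩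
    rw [hQdef, ← Finset.mul_prod_erase _ _ (Finset.mem_univ i), pow_succ,
      ← one_sub_mul_geomCofactor (hdvd i)]
    ring
  have hcoeff : ∀ n ≥ Q.natDegree,
      ∑ a ∈ factorizations gen n, ∏ i, ((a i + e i).choose (e i) : ℝ) =
        ∑ j ∈ Finset.range (Q.natDegree + 1), (if (j : ZMod L) = n then Q.coeff j else 0) *
          ((D + (n - j) / L).choose D : ℝ) := by
    intro n hn
    have h := congrArg (PowerSeries.coeff n) (prod_negBinomialSeries hL hpos hdvd e hD)
    simp only [negBinomialSeries] at h
    rw [coeff_prod_spreadSeries hpos] at h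
    have hsymm : ∀ a : Fin k → ℕ, ∏ i, ((e i + a i).choose (e i) : ℝ) =
        ∏ i, ((a i + e i).choose (e i) : ℝ) :=
      fun a => Finset.prod_congr rfl fun i _ => by rw [Nat.add_comm]
    simp only [hsymm] at h
    rw [h, PowerSeries.coeff_mul, Finset.Nat.sum_antidiagonal_eq_sum_range_succ_mk]
    symm
    refine (Finset.sum_subset (Finset.range_mono (by omega)) fun j _ hj => ?_).trans
      (Finset.sum_congr rfl fun j hj => ?_)
    · rw [Polynomial.coeff_eq_zero_of_natDegree_lt (by simpa using hj)]
      simp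
    · have hjn : j ≤ n := by simpa [Nat.lt_succ_iff] using hj
      have hiff : (j : ZMod L) = n ↔ L ∣ n - j := by
        rw [ZMod.natCast_eq_natCast_iff, Nat.modEq_iff_dvd' hjn]
      simp only [spreadSeries, PowerSeries.coeff_mk, Polynomial.coeff_coe, hiff]
      split_ifs <;> simp [hQdef]
  set c₀ : ℝ := 1 / (L ^ D * D.factorial) with hc₀
  have hlim : Q.eval 1 / L * c₀ = 1 / (D.factorial * ∏ i, (gen i : ℝ) ^ (e i + 1)) := by
    have hL0 : (L : ℝ) ≠ 0 := by exact_mod_cast hL.ne'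
    have hQ1 : Q.eval 1 = (L : ℝ) ^ (D + 1) / ∏ i, (gen i : ℝ) ^ (e i + 1) := by
      rw [← hD, ← Finset.prod_pow_eq_pow_sum, ← Finset.prod_div_distrib, hQdef,
        Polynomial.eval_prod]
      refine Finset.prod_congr rfl fun i _ => ?_
      rw [Polynomial.eval_pow, eval_one_geomCofactor, Nat.cast_div (hdvd i)
        (by exact_mod_cast (hpos i).ne'), div_pow]
    have hP : ∏ i, (gen i : ℝ) ^ (e i + 1) ≠ 0 :=
      Finset.prod_ne_zero_iff.2 fun i _ => pow_ne_zero _ (by exact_mod_cast (hpos i).ne')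
    rw [hQ1, hc₀, pow_succ]
    field_simp
  have hdiff : Tendsto (fun n : ℕ => ∑ j ∈ Finset.range (Q.natDegree + 1),
      (if (j : ZMod L) = n then Q.coeff j else 0) *
        (((D + (n - j) / L).choose D : ℝ) / (n : ℝ) ^ D - c₀)) atTop (𝓝 0) := by
    rw [← Finset.sum_const_zero (s := Finset.range (Q.natDegree + 1))]
    refine tendsto_finsetSum _ fun j _ => ?_
    have h0 : Tendsto (fun n : ℕ => ((D + (n - j) / L).choose D : ℝ) / (n : ℝ) ^ D - c₀) atTop
        (𝓝 0) := by
      rw [← sub_self c₀]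
      exact (tendsto_choose_div_pow hL j D).sub_const c₀
    refine squeeze_zero_norm (fun n => ?_) (by simpa using h0.norm.const_mul |Q.coeff j|)
    rw [norm_mul]
    gcongr
    · split_ifs <;> simp
    · exact le_rfl
  rw [← hlim]
  have := hdiff.add_const (Q.eval 1 / L * c₀)
  rw [zero_add] at this
  refine this.congr' ?_
  filter_upwards [eventually_ge_atTop Q.natDegree] with n hn
  rw [hcoeff n hn, ← hQ n, residueSum_eq_sum_range, Finset.sum_mul, ← Finset.sum_add_distrib,
    Finset.sum_div]
  refine Finset.sum_congr rfl fun j _ => ?_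
  ring

/-! ### Moments of the normalized lengths -/

theorem length_le {k : ℕ} {gen : Fin k → ℕ} (hpos : ∀ i, 0 < gen i) {n : ℕ} {a : Fin k → ℕ}
    (ha : a ∈ factorizations gen n) : ∑ i, a i ≤ n := by
  rw [← (mem_factorizations hpos n a).1 ha]
  exact Finset.sum_le_sum fun i _ => Nat.le_mul_of_pos_right _ (hpos i)

theorem tendsto_sum_choose_length {k : ℕ} (hk : 1 ≤ k) {gen : Fin k → ℕ} (hpos : ∀ i, 0 < gen i)
    (hgcd : Finset.univ.gcd gen = 1) (p : ℕ) :
    Tendsto (fun n : ℕ =>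
        (∑ a ∈ factorizations gen n, ((∑ i, a i + (k - 1) + p).choose p : ℝ)) /
          (n : ℝ) ^ (k - 1 + p)) atTop
      (𝓝 (MvPolynomial.eval (fun i => 1 / (gen i : ℝ)) (MvPolynomial.hsymm (Fin k) ℝ p) /
        ((k - 1 + p).factorial * ∏ i, (gen i : ℝ)))) := by
  have h : ∀ e ∈ factorizations (fun _ : Fin k => 1) p, _ := fun e he =>
    tendsto_sum_prod_choose hpos hgcd e (D := k - 1 + p) (by
      have := (mem_factorizations (fun _ => one_pos) p e).1 he
      rw [Finset.sum_add_distrib]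
      simp at this ⊢
      omega)
  convert tendsto_finsetSum _ h using 2 with n
  · rw [← Finset.sum_div, Finset.sum_comm]
    congr 1
    exact Finset.sum_congr rfl fun a _ => (sum_prod_choose hk a p).symm
  · rw [eval_hsymm_eq_sum, Finset.sum_div]
    refine Finset.sum_congr rfl fun e _ => ?_
    simp only [pow_succ, Finset.prod_mul_distrib, one_div, inv_pow, Finset.prod_inv_distrib]
    rw [div_eq_mul_inv, ← mul_inv]
    congr 1
    ring

theorem add_pow_sub_pow_le {x δ : ℝ} (hx : 0 ≤ x) (hx1 : x ≤ 1) (hδ : 0 ≤ δ) (p : ℕ) :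
    (x + δ) ^ p - x ^ p ≤ (1 + δ) ^ p - 1 := by
  induction p with
  | zero => simp
  | succ p ih =>
    have h0 : x ^ p ≤ 1 := pow_le_one₀ hx hx1
    have h1 : 0 ≤ (1 + δ) ^ p - 1 := sub_nonneg.2 (one_le_pow₀ (by linarith))
    have h2 : (x + δ) * ((x + δ) ^ p - x ^ p) ≤ (1 + δ) * ((1 + δ) ^ p - 1) :=
      mul_le_mul (by linarith) ih (sub_nonneg.2 (by gcongr; linarith)) (by linarith)
    have h3 : δ * x ^ p ≤ δ * 1 := by gcongr
    calc (x + δ) ^ (p + 1) - x ^ (p + 1)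
        = (x + δ) * ((x + δ) ^ p - x ^ p) + δ * x ^ p := by ring
      _ ≤ (1 + δ) * ((1 + δ) ^ p - 1) + δ * 1 := add_le_add h2 h3
      _ = (1 + δ) ^ (p + 1) - 1 := by ring

/-- Rising binomial coefficients are asymptotically pure powers, uniformly for lengths at most
`n`. -/
theorem abs_choose_sub_pow_le {n l : ℕ} (hn : 0 < n) (hl : l ≤ n) (c p : ℕ) :
    |(p.factorial * ((l + c + p).choose p : ℝ)) / (n : ℝ) ^ p - ((l : ℝ) / n) ^ p| ≤
      (1 + (c + p) / n : ℝ) ^ p - 1 := by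
  have hn0 : (0 : ℝ) < n := by exact_mod_cast hn
  have hdesc : (p.factorial * ((l + c + p).choose p : ℝ)) = ((l + c + p).descFactorial p : ℝ) := by
    rw [Nat.descFactorial_eq_factorial_mul_choose]; push_cast; rfl
  have hlo : ((l : ℝ)) ^ p ≤ ((l + c + p).descFactorial p : ℝ) := by
    have h := Nat.pow_sub_le_descFactorial (l + c + p) p
    have h' : l ^ p ≤ (l + c + p + 1 - p) ^ p := Nat.pow_le_pow_left (by omega) p
    exact_mod_cast h'.trans h
  have hhi : ((l + c + p).descFactorial p : ℝ) ≤ ((l : ℝ) + (c + p)) ^ p := by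
    have h := Nat.descFactorial_le_pow (l + c + p) p
    rw [← add_assoc]
    exact_mod_cast h
  rw [hdesc, abs_of_nonneg (by rw [div_pow, sub_nonneg]; gcongr)]
  refine le_trans ?_ (add_pow_sub_pow_le (x := (l : ℝ) / n) (by positivity)
    ((div_le_one hn0).2 (by exact_mod_cast hl)) (by positivity) p)
  rw [← add_div, div_pow ((l : ℝ) + _)]
  gcongr

/-- The number of factorizations of `n` is asymptotic to `n ^ (k - 1) / ((k - 1)! ∏ gen i)`. -/
theorem tendsto_card_div_pow {k : ℕ} (hk : 1 ≤ k) {gen : Fin k → ℕ} (hpos : ∀ i, 0 < gen i)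
    (hgcd : Finset.univ.gcd gen = 1) :
    Tendsto (fun n : ℕ => ((factorizations gen n).card : ℝ) / (n : ℝ) ^ (k - 1)) atTop
      (𝓝 (1 / ((k - 1).factorial * ∏ i, (gen i : ℝ)))) := by
  simpa [MvPolynomial.hsymm_zero] using tendsto_sum_choose_length hk hpos hgcd 0

theorem eventually_card_pos {k : ℕ} (hk : 1 ≤ k) {gen : Fin k → ℕ} (hpos : ∀ i, 0 < gen i)
    (hgcd : Finset.univ.gcd gen = 1) : ∀ᶠ n in atTop, 0 < (factorizations gen n).card := by
  have hpos' : (0 : ℝ) < 1 / ((k - 1).factorial * ∏ i, (gen i : ℝ)) := by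
    have : 0 < ∏ i, (gen i : ℝ) := Finset.prod_pos fun i _ => by exact_mod_cast hpos i
    positivity
  filter_upwards [(tendsto_card_div_pow hk hpos hgcd).eventually_const_lt hpos'] with n hn
  by_contra h
  have h0 : (factorizations gen n).card = 0 := by omega
  simp [h0] at hn

theorem tendsto_mean_length_pow {k : ℕ} (hk : 1 ≤ k) {gen : Fin k → ℕ} (hpos : ∀ i, 0 < gen i)
    (hgcd : Finset.univ.gcd gen = 1) (p : ℕ) :
    Tendsto (fun n : ℕ =>
        (∑ a ∈ factorizations gen n, (((∑ i, a i : ℕ) : ℝ) / n) ^ p) /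
          ((factorizations gen n).card : ℝ)) atTop
      (𝓝 (((p + k - 1).choose p : ℝ)⁻¹ *
        MvPolynomial.eval (fun i => 1 / (gen i : ℝ)) (MvPolynomial.hsymm (Fin k) ℝ p))) := by
  have hP : ∏ i, (gen i : ℝ) ≠ 0 :=
    Finset.prod_ne_zero_iff.2 fun i _ => by exact_mod_cast (hpos i).ne'
  have hcard := tendsto_card_div_pow hk hpos hgcd
  have hcard0 : 1 / ((k - 1).factorial * ∏ i, (gen i : ℝ)) ≠ 0 := by positivity
  -- the mean of the rising binomial coefficients
  have hmain := ((tendsto_sum_choose_length hk hpos hgcd p).div hcard hcard0).const_mul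
    (p.factorial : ℝ)
  -- the error made by replacing them with powers
  have herr : Tendsto (fun n : ℕ => (1 + (((k - 1 : ℕ) : ℝ) + p) / n : ℝ) ^ p - 1) atTop (𝓝 0) := by
    have := (((tendsto_const_div_atTop_nhds_zero_nat (((k - 1 : ℕ) : ℝ) + p)).const_add 1).pow
      p).sub_const 1
    simpa using this
  have hval : (p.factorial : ℝ) *
      (MvPolynomial.eval (fun i => 1 / (gen i : ℝ)) (MvPolynomial.hsymm (Fin k) ℝ p) /
        ((k - 1 + p).factorial * ∏ i, (gen i : ℝ)) / (1 / ((k - 1).factorial * ∏ i, (gen i : ℝ)))) =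
      ((p + k - 1).choose p : ℝ)⁻¹ *
        MvPolynomial.eval (fun i => 1 / (gen i : ℝ)) (MvPolynomial.hsymm (Fin k) ℝ p) := by
    have hc := Nat.add_choose_mul_factorial_mul_factorial (k - 1) p
    have hc' : ((k - 1 + p).choose p : ℝ) * (k - 1).factorial * p.factorial =
        (k - 1 + p).factorial := by exact_mod_cast hc
    have hch : ((k - 1 + p).choose p : ℝ) ≠ 0 := by
      exact_mod_cast (Nat.choose_pos (by omega)).ne'
    rw [show p + k - 1 = k - 1 + p by omega, ← hc']
    have := Nat.factorial_ne_zero (k - 1)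
    have := Nat.factorial_ne_zero p
    field_simp
  rw [hval] at hmain
  refine (tendsto_iff_of_dist ?_).1 hmain
  refine squeeze_zero' (Eventually.of_forall fun _ => dist_nonneg) ?_ herr
  filter_upwards [eventually_gt_atTop 0, eventually_card_pos hk hpos hgcd] with n hn hc
  have hn0 : (n : ℝ) ≠ 0 := by exact_mod_cast hn.ne'
  have hc0 : (0 : ℝ) < (factorizations gen n).card := by exact_mod_cast hc
  have heq : (p.factorial : ℝ) *
      ((∑ a ∈ factorizations gen n, ((∑ i, a i + (k - 1) + p).choose p : ℝ)) /
          (n : ℝ) ^ (k - 1 + p) / ((factorizations gen n).card / (n : ℝ) ^ (k - 1))) =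
      (∑ a ∈ factorizations gen n,
        (p.factorial * ((∑ i, a i + (k - 1) + p).choose p : ℝ)) / (n : ℝ) ^ p) /
          (factorizations gen n).card := by
    rw [← Finset.sum_div, ← Finset.mul_sum, pow_add]
    field_simp
  simp only [Pi.div_apply]
  rw [heq, Real.dist_eq, ← sub_div, ← Finset.sum_sub_distrib, abs_div, abs_of_pos hc0,
    div_le_iff₀ hc0]
  refine (Finset.abs_sum_le_sum_abs _ _).trans ?_
  rw [mul_comm, ← nsmul_eq_mul]
  exact Finset.sum_le_card_nsmul _ _ _ fun a ha =>
    abs_choose_sub_pow_le hn (length_le hpos ha) (k - 1) p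

/-! ### The density as a spline and its moments -/

/-- The denominators `∏_{j ≠ r} (nⱼ - nᵣ)` of the density. -/
noncomputable def nodeProd {k : ℕ} (gen : Fin k → ℕ) (r : Fin k) : ℝ :=
  ∏ j ∈ Finset.univ.erase r, ((gen j : ℝ) - gen r)

theorem nodeProd_ne_zero {k : ℕ} {gen : Fin k → ℕ} (hinj : Function.Injective gen) (r : Fin k) :
    nodeProd gen r ≠ 0 := by
  refine Finset.prod_ne_zero_iff.2 fun j hj => sub_ne_zero.2 ?_
  exact_mod_cast hinj.ne (Finset.ne_of_mem_erase hj)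

/-- Divided differences of order `k - 1` annihilate polynomials of degree less than `k - 1`. -/
theorem sum_eval_div_nodeProd {k : ℕ} {gen : Fin k → ℕ} (hinj : Function.Injective gen)
    (P : Polynomial ℝ) (hP : P.natDegree < k - 1) :
    ∑ r, P.eval (-(gen r : ℝ)) / nodeProd gen r = 0 := by
  have hv : Set.InjOn (fun r => -(gen r : ℝ)) (Finset.univ : Finset (Fin k)) := by
    intro a _ b _ hab
    exact hinj (by exact_mod_cast neg_injective hab)
  have hdeg : P.degree < (Finset.univ : Finset (Fin k)).card := by
    refine Polynomial.degree_le_natDegree.trans_lt ?_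
    rw [Finset.card_univ, Fintype.card_fin]
    exact_mod_cast (by omega : P.natDegree < k)
  have h := Lagrange.coeff_eq_sum hv hdeg
  rw [Finset.card_univ, Fintype.card_fin, Polynomial.coeff_eq_zero_of_natDegree_lt hP] at h
  rw [h]
  refine Finset.sum_congr rfl fun r _ => ?_
  rw [nodeProd]
  congr 1
  exact Finset.prod_congr rfl fun j _ => by ring

theorem sum_pow_div_nodeProd {k : ℕ} (hk : 3 ≤ k) {gen : Fin k → ℕ}
    (hinj : Function.Injective gen) (x : ℝ) :
    ∑ r, (1 - gen r * x) ^ (k - 2) / nodeProd gen r = 0 := by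
  have hdeg : ((1 + Polynomial.C x * Polynomial.X : Polynomial ℝ) ^ (k - 2)).natDegree < k - 1 := by
    have h1 : (1 + Polynomial.C x * Polynomial.X : Polynomial ℝ).natDegree ≤ 1 := by
      compute_degree
    have h2 := Polynomial.natDegree_pow_le_of_le (k - 2) h1
    omega
  rw [← sum_eval_div_nodeProd hinj _ hdeg]
  refine Finset.sum_congr rfl fun r _ => ?_
  simp only [Polynomial.eval_pow, Polynomial.eval_add, Polynomial.eval_one, Polynomial.eval_mul,
    Polynomial.eval_C, Polynomial.eval_X]
  ring

/-- The density is a B-spline, written in truncated powers. -/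
theorem lengthDensity_eq {k : ℕ} (hk : 3 ≤ k) {gen : Fin k → ℕ}
    (hinj : Function.Injective gen) (x : ℝ) :
    lengthDensity gen x = ((k : ℝ) - 1) * (∏ i, (gen i : ℝ)) *
      ∑ r, max (1 - gen r * x) 0 ^ (k - 2) / nodeProd gen r := by
  have habs : ∀ u : ℝ, |u| * u ^ (k - 3) = 2 * max u 0 ^ (k - 2) - u ^ (k - 2) := by
    intro u
    obtain ⟨m, hm⟩ : ∃ m, k - 2 = m + 1 := ⟨k - 3, by omega⟩
    rw [hm, show k - 3 = m by omega]
    rcases le_total 0 u with h | h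
    · rw [abs_of_nonneg h, max_eq_left h]; ring
    · rw [abs_of_nonpos h, max_eq_right h]; ring
  have hsum : ∑ r, |1 - (gen r : ℝ) * x| * (1 - (gen r : ℝ) * x) ^ (k - 3) /
      ∏ j ∈ Finset.univ.erase r, ((gen j : ℝ) - (gen r : ℝ)) =
      2 * ∑ r, max (1 - gen r * x) 0 ^ (k - 2) / nodeProd gen r := by
    have h := sum_pow_div_nodeProd hk hinj x
    rw [← sub_eq_self (a := 2 * _)] at h
    rw [← h, Finset.mul_sum, ← Finset.sum_sub_distrib]
    refine Finset.sum_congr rfl fun r _ => ?_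
    rw [habs, ← nodeProd]
    ring
  rw [lengthDensity, hsum]
  ring

theorem continuous_lengthDensity {k : ℕ} (gen : Fin k → ℕ) : Continuous (lengthDensity gen) := by
  unfold lengthDensity
  fun_prop

theorem lengthDensity_eq_zero {k : ℕ} (hk : 3 ≤ k) {gen : Fin k → ℕ} (hpos : ∀ i, 0 < gen i)
    (hmono : StrictMono gen) {x : ℝ}
    (hx : x ∉ Set.Icc (1 / (gen ⟨k - 1, Nat.sub_one_lt_of_lt hk⟩ : ℝ))
      (1 / (gen ⟨0, Nat.zero_lt_of_lt hk⟩ : ℝ))) :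
    lengthDensity gen x = 0 := by
  have hpos' : ∀ i, (0 : ℝ) < gen i := fun i => by exact_mod_cast hpos i
  rw [lengthDensity_eq hk hmono.injective]
  rw [Set.mem_Icc, not_and_or, not_le, not_le, lt_div_iff₀ (hpos' _), div_lt_iff₀ (hpos' _)] at hx
  rcases hx with hx | hx
  · have hle : ∀ r, 0 ≤ 1 - gen r * x := by
      intro r
      have h1 : (gen r : ℝ) ≤ gen ⟨k - 1, Nat.sub_one_lt_of_lt hk⟩ := by
        exact_mod_cast hmono.monotone (Fin.le_def.2 (by simp; omega))
      rcases le_total 0 x with h | h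
      · nlinarith
      · nlinarith [hpos' r]
    simp only [max_eq_left (hle _), sum_pow_div_nodeProd hk hmono.injective, mul_zero]
  · have hle : ∀ r, 1 - gen r * x ≤ 0 := by
      intro r
      have h1 : (gen ⟨0, Nat.zero_lt_of_lt hk⟩ : ℝ) ≤ gen r := by
        exact_mod_cast hmono.monotone (Fin.le_def.2 (by simp))
      have h0 : 0 < x := by
        by_contra h
        nlinarith [hpos' ⟨0, Nat.zero_lt_of_lt hk⟩]
      nlinarith
    simp [max_eq_right (hle _), show k - 2 ≠ 0 by omega]

theorem integral_pow_mul_one_sub_pow (p q : ℕ) :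
    ∫ t in (0 : ℝ)..1, t ^ p * (1 - t) ^ q =
      (p.factorial * q.factorial : ℝ) / (p + q + 1).factorial := by
  induction q generalizing p with
  | zero =>
    simp only [pow_zero, mul_one, integral_pow, Nat.factorial_zero, Nat.add_zero]
    rw [Nat.factorial_succ]
    have := Nat.factorial_ne_zero p
    push_cast
    field_simp
    simp
  | succ q ih =>
    have h : ∀ t : ℝ, t ^ p * (1 - t) ^ (q + 1) =
        t ^ p * (1 - t) ^ q - t ^ (p + 1) * (1 - t) ^ q := fun t => by ring
    simp only [h]
    rw [intervalIntegral.integral_sub (by apply Continuous.intervalIntegrable; fun_prop)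
      (by apply Continuous.intervalIntegrable; fun_prop), ih, ih,
      show p + 1 + q + 1 = (p + q + 1) + 1 by ring, show p + (q + 1) + 1 = (p + q + 1) + 1 by ring,
      Nat.factorial_succ (p + q + 1), Nat.factorial_succ p, Nat.factorial_succ q]
    have := Nat.factorial_ne_zero (p + q + 1)
    push_cast
    field_simp
    ring

theorem integral_pow_mul_truncated_pow {m : ℕ} (hm : 0 < m) (p : ℕ) {q : ℕ} (hq : q ≠ 0) :
    ∫ t in (0 : ℝ)..1, t ^ p * max (1 - m * t) 0 ^ q =
      (1 / (m : ℝ)) ^ (p + 1) * ((p.factorial * q.factorial : ℝ) / (p + q + 1).factorial) := by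
  have hm0 : (0 : ℝ) < m := by exact_mod_cast hm
  have hc : Continuous fun t : ℝ => t ^ p * max (1 - m * t) 0 ^ q := by fun_prop
  rw [← intervalIntegral.integral_add_adjacent_intervals (hc.intervalIntegrable 0 (1 / m))
    (hc.intervalIntegrable _ _)]
  have h2 : ∫ t in (1 / m : ℝ)..1, t ^ p * max (1 - m * t) 0 ^ q = 0 := by
    rw [intervalIntegral.integral_congr (g := fun _ => 0), intervalIntegral.integral_zero]
    intro t ht
    rw [Set.uIcc_of_le ((div_le_one hm0).2 (by exact_mod_cast hm))] at ht
    have h := (div_le_iff₀ hm0).1 ht.1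
    have : max (1 - m * t) 0 = 0 := max_eq_right (by linarith)
    simp [this, hq]
  have h1 : ∫ t in (0 : ℝ)..(1 / m), t ^ p * max (1 - m * t) 0 ^ q =
      ∫ t in (0 : ℝ)..(1 / m), (1 / m : ℝ) ^ p * ((m * t) ^ p * (1 - m * t) ^ q) := by
    refine intervalIntegral.integral_congr fun t ht => ?_
    rw [Set.uIcc_of_le (by positivity)] at ht
    have h := (le_div_iff₀ hm0).1 ht.2
    have : max (1 - m * t) 0 = 1 - m * t := max_eq_left (by linarith)
    simp only [this]
    rw [← mul_assoc, ← mul_pow, ← mul_assoc, one_div_mul_cancel hm0.ne', one_mul]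
  rw [h1, h2, add_zero, intervalIntegral.integral_const_mul,
    intervalIntegral.integral_comp_mul_left (fun u => u ^ p * (1 - u) ^ q) hm0.ne',
    mul_zero, mul_one_div_cancel hm0.ne', integral_pow_mul_one_sub_pow, smul_eq_mul]
  ring

/-- The partial fraction decomposition of `∏ (1 - X / nᵢ)⁻¹`, compared coefficientwise: it
is the identity `∑ r, Lagrange.basis r = 1` divided by `∏ (1 - X / nᵢ)`. -/
theorem eval_hsymm_inv {k : ℕ} (hk : 1 ≤ k) {gen : Fin k → ℕ} (hpos : ∀ i, 0 < gen i)
    (hinj : Function.Injective gen) (p : ℕ) :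
    MvPolynomial.eval (fun i => 1 / (gen i : ℝ)) (MvPolynomial.hsymm (Fin k) ℝ p) =
      (∏ i, (gen i : ℝ)) * ∑ r, (1 / (gen r : ℝ)) ^ (p + 1) / nodeProd gen r := by
  have hne : ∀ i, (gen i : ℝ) ≠ 0 := fun i => by exact_mod_cast (hpos i).ne'
  set H : Fin k → PowerSeries ℝ := fun i => PowerSeries.mk fun n => (1 / (gen i : ℝ)) ^ n with hH
  have hgeom : ∀ i, (1 - PowerSeries.C (1 / (gen i : ℝ)) * PowerSeries.X) * H i = 1 := by
    intro i
    ext n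
    rw [sub_mul, one_mul, mul_assoc, map_sub, PowerSeries.coeff_C_mul]
    cases n with
    | zero => simp [hH]
    | succ n =>
      rw [PowerSeries.coeff_succ_X_mul]
      simp only [hH, PowerSeries.coeff_mk, PowerSeries.coeff_one]
      simp [pow_succ']
  set w : Fin k → ℝ := fun r => (∏ i, (gen i : ℝ)) / gen r / nodeProd gen r with hw
  have hbasis : ∀ r, ((Lagrange.basis Finset.univ (fun i => (gen i : ℝ)) r : Polynomial ℝ) :
      PowerSeries ℝ) = PowerSeries.C (w r) *
        ∏ j ∈ Finset.univ.erase r, (1 - PowerSeries.C (1 / (gen j : ℝ)) * PowerSeries.X) := by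
    intro r
    have hwr : w r = ∏ j ∈ Finset.univ.erase r, ((gen j : ℝ) / (gen j - gen r)) := by
      rw [hw, Finset.prod_div_distrib, ← Finset.mul_prod_erase _ _ (Finset.mem_univ r)]
      simp only [nodeProd]
      rw [mul_div_cancel_left₀ _ (hne r)]
    rw [hwr, Lagrange.basis, ← Polynomial.coeToPowerSeries.ringHom_apply, map_prod, map_prod,
      ← Finset.prod_mul_distrib]
    refine Finset.prod_congr rfl fun j hj => ?_
    have hjr : (gen j : ℝ) - gen r ≠ 0 := sub_ne_zero.2 (by
      exact_mod_cast hinj.ne (Finset.ne_of_mem_erase hj))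
    have hrj : (gen r : ℝ) - gen j ≠ 0 := by rw [← neg_sub]; exact neg_ne_zero.2 hjr
    rw [Lagrange.basisDivisor]
    simp only [Polynomial.coeToPowerSeries.ringHom_apply, Polynomial.coe_mul, Polynomial.coe_C,
      Polynomial.coe_sub, Polynomial.coe_X]
    rw [mul_sub, mul_sub, ← mul_assoc, ← map_mul, ← map_mul, mul_one]
    have e1 : ((gen r : ℝ) - gen j)⁻¹ = -(gen j / (gen j - gen r) * (1 / gen j)) := by
      have := hne j
      rw [← neg_sub (gen j : ℝ)]
      field_simp
    have e2 : ((gen r : ℝ) - gen j)⁻¹ * gen j = -(gen j / (gen j - gen r)) := by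
      rw [← neg_sub (gen j : ℝ)]
      field_simp
    rw [e2, e1, map_neg, map_neg]
    ring
  have hone : ∑ r, ((Lagrange.basis Finset.univ (fun i => (gen i : ℝ)) r : Polynomial ℝ) :
      PowerSeries ℝ) = 1 := by
    have hv : Set.InjOn (fun i => (gen i : ℝ)) (Finset.univ : Finset (Fin k)) :=
      fun a _ b _ hab => hinj (Nat.cast_injective hab)
    have h := congrArg (Polynomial.coeToPowerSeries.ringHom (R := ℝ))
      (Lagrange.sum_basis hv ⟨⟨0, Nat.zero_lt_of_lt hk⟩, Finset.mem_univ _⟩)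
    rwa [map_sum, map_one] at h
  have hprod : ∏ i, H i = ∑ r, PowerSeries.C (w r) * H r := by
    rw [← one_mul (∏ i, H i), ← hone, Finset.sum_mul]
    refine Finset.sum_congr rfl fun r _ => ?_
    rw [hbasis, ← Finset.mul_prod_erase _ H (Finset.mem_univ r), mul_assoc, mul_left_comm _ (H r),
      ← Finset.prod_mul_distrib, Finset.prod_congr rfl fun j _ => hgeom j, Finset.prod_const_one,
      mul_one]
  rw [eval_hsymm_eq_coeff, hprod, map_sum, Finset.mul_sum]
  refine Finset.sum_congr rfl fun r _ => ?_
  rw [PowerSeries.coeff_C_mul]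
  simp only [hH, hw, PowerSeries.coeff_mk]
  rw [pow_succ]
  ring

theorem integral_pow_mul_lengthDensity {k : ℕ} (hk : 3 ≤ k) {gen : Fin k → ℕ}
    (hpos : ∀ i, 0 < gen i) (hinj : Function.Injective gen) (p : ℕ) :
    ∫ t in (0 : ℝ)..1, t ^ p * lengthDensity gen t =
      ((p + k - 1).choose p : ℝ)⁻¹ *
        MvPolynomial.eval (fun i => 1 / (gen i : ℝ)) (MvPolynomial.hsymm (Fin k) ℝ p) := by
  have hexp : ∀ t : ℝ, t ^ p * lengthDensity gen t =
      ∑ r, ((k : ℝ) - 1) * (∏ i, (gen i : ℝ)) / nodeProd gen r *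
        (t ^ p * max (1 - gen r * t) 0 ^ (k - 2)) := by
    intro t
    rw [lengthDensity_eq hk hinj, Finset.mul_sum, Finset.mul_sum]
    refine Finset.sum_congr rfl fun r _ => ?_
    ring
  simp only [hexp]
  rw [intervalIntegral.integral_finsetSum fun r _ => by
    apply Continuous.intervalIntegrable; fun_prop]
  simp only [intervalIntegral.integral_const_mul,
    integral_pow_mul_truncated_pow (hpos _) p (show k - 2 ≠ 0 by omega)]
  rw [eval_hsymm_inv (by omega) hpos hinj, Finset.mul_sum, Finset.mul_sum]
  refine Finset.sum_congr rfl fun r _ => ?_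
  obtain ⟨q, rfl⟩ : ∃ q, k = q + 2 := ⟨k - 2, by omega⟩
  have hc := Nat.add_choose_mul_factorial_mul_factorial (q + 1) p
  have hc' : ((q + 1 + p).choose p : ℝ) * (q + 1).factorial * p.factorial =
      (q + 1 + p).factorial := by exact_mod_cast hc
  have hch : ((q + 1 + p).choose p : ℝ) ≠ 0 := by
    exact_mod_cast (Nat.choose_pos (by omega)).ne'
  rw [show p + (q + 2) - 1 = q + 1 + p by omega, show q + 2 - 2 = q by omega,
    show p + q + 1 = q + 1 + p by omega, ← hc', Nat.factorial_succ]
  have := Nat.factorial_ne_zero q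
  have := Nat.factorial_ne_zero p
  have := nodeProd_ne_zero hinj r
  push_cast
  field_simp
  ring

/-! ### Averages of continuous functions -/

theorem length_div_mem_Icc {k : ℕ} (hk : 3 ≤ k) {gen : Fin k → ℕ} (hpos : ∀ i, 0 < gen i)
    (hmono : StrictMono gen) {n : ℕ} (hn : 0 < n) {a : Fin k → ℕ}
    (ha : a ∈ factorizations gen n) :
    ((∑ i, a i : ℕ) : ℝ) / n ∈
      Set.Icc (1 / (gen ⟨k - 1, Nat.sub_one_lt_of_lt hk⟩ : ℝ))
        (1 / (gen ⟨0, Nat.zero_lt_of_lt hk⟩ : ℝ)) := by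
  have hpos' : ∀ i, (0 : ℝ) < gen i := fun i => by exact_mod_cast hpos i
  have hn0 : (0 : ℝ) < n := by exact_mod_cast hn
  have hsum := (mem_factorizations hpos n a).1 ha
  have hlo : (∑ i, a i) * gen ⟨0, Nat.zero_lt_of_lt hk⟩ ≤ n := by
    rw [← hsum, Finset.sum_mul]
    exact Finset.sum_le_sum fun i _ =>
      Nat.mul_le_mul_left _ (hmono.monotone (Fin.le_def.2 (by simp)))
  have hhi : n ≤ (∑ i, a i) * gen ⟨k - 1, Nat.sub_one_lt_of_lt hk⟩ := by
    rw [← hsum, Finset.sum_mul]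
    exact Finset.sum_le_sum fun i _ =>
      Nat.mul_le_mul_left _ (hmono.monotone (Fin.le_def.2 (by simp; omega)))
  constructor
  · rw [div_le_div_iff₀ (hpos' _) hn0, one_mul]
    exact_mod_cast hhi
  · rw [div_le_div_iff₀ hn0 (hpos' _), one_mul]
    exact_mod_cast hlo

theorem Icc_inv_subset_Ioc {k : ℕ} (hk : 3 ≤ k) {gen : Fin k → ℕ} (hpos : ∀ i, 0 < gen i) :
    Set.Icc (1 / (gen ⟨k - 1, Nat.sub_one_lt_of_lt hk⟩ : ℝ))
      (1 / (gen ⟨0, Nat.zero_lt_of_lt hk⟩ : ℝ)) ⊆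
      Set.Ioc 0 1 := by
  have hpos' : ∀ i, (0 : ℝ) < gen i := fun i => by exact_mod_cast hpos i
  intro x hx
  refine ⟨(one_div_pos.2 (hpos' _)).trans_le hx.1, hx.2.trans ?_⟩
  rw [div_le_one (hpos' _)]
  exact_mod_cast hpos _

/-- The average of `f (ℓ / n)` over the lengths `ℓ` of the factorizations of `n`. -/
noncomputable def lengthMean {k : ℕ} (gen : Fin k → ℕ) (f : ℝ → ℝ) (n : ℕ) : ℝ :=
  (∑ a ∈ factorizations gen n, f (((∑ i, a i : ℕ) : ℝ) / n)) / (factorizations gen n).card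

theorem lengthMean_mono {k : ℕ} {gen : Fin k → ℕ} {f g : ℝ → ℝ} (h : ∀ x, f x ≤ g x) (n : ℕ) :
    lengthMean gen f n ≤ lengthMean gen g n := by
  unfold lengthMean
  gcongr
  exact h _

theorem tendsto_lengthMean_polynomial {k : ℕ} (hk : 3 ≤ k) {gen : Fin k → ℕ}
    (hpos : ∀ i, 0 < gen i) (hmono : StrictMono gen) (hgcd : Finset.univ.gcd gen = 1)
    (P : Polynomial ℝ) :
    Tendsto (lengthMean gen fun x => P.eval x) atTop
      (𝓝 (∫ t in (0 : ℝ)..1, P.eval t * lengthDensity gen t)) := by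
  have hF := continuous_lengthDensity gen
  have h := tendsto_finsetSum (Finset.range (P.natDegree + 1)) fun p _ =>
    (tendsto_mean_length_pow (by omega) hpos hgcd p).const_mul (P.coeff p)
  convert h using 1
  · funext n
    simp only [lengthMean, Polynomial.eval_eq_sum_range]
    rw [Finset.sum_comm, Finset.sum_div]
    refine Finset.sum_congr rfl fun p _ => ?_
    rw [← Finset.mul_sum, mul_div_assoc]
  · congr 1
    simp only [Polynomial.eval_eq_sum_range, Finset.sum_mul]
    rw [intervalIntegral.integral_finsetSum fun p _ => by
      apply Continuous.intervalIntegrable; fun_prop]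
    refine Finset.sum_congr rfl fun p _ => ?_
    simp only [mul_assoc]
    rw [intervalIntegral.integral_const_mul,
      integral_pow_mul_lengthDensity hk hpos hmono.injective]

/-- Convergence of moments implies weak convergence, by Weierstrass approximation on `[0, 1]`. -/
theorem tendsto_lengthMean {k : ℕ} (hk : 3 ≤ k) {gen : Fin k → ℕ}
    (hpos : ∀ i, 0 < gen i) (hmono : StrictMono gen) (hgcd : Finset.univ.gcd gen = 1)
    {f : ℝ → ℝ} (hf : Continuous f) :
    Tendsto (lengthMean gen f) atTop (𝓝 (∫ t in (0 : ℝ)..1, f t * lengthDensity gen t)) := by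
  have hF := continuous_lengthDensity gen
  set C : ℝ := ∫ t in (0 : ℝ)..1, |lengthDensity gen t| with hC
  have hC0 : 0 ≤ C := intervalIntegral.integral_nonneg zero_le_one fun _ _ => abs_nonneg _
  rw [Metric.tendsto_nhds]
  intro ε hε
  set δ : ℝ := ε / (C + 2) with hδdef
  have hδ : 0 < δ := by positivity
  obtain ⟨P, hP⟩ := exists_polynomial_near_of_continuousOn 0 1 f hf.continuousOn δ hδ
  have hint : |(∫ t in (0 : ℝ)..1, P.eval t * lengthDensity gen t) -
      ∫ t in (0 : ℝ)..1, f t * lengthDensity gen t| ≤ δ * C := by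
    rw [← intervalIntegral.integral_sub (by apply Continuous.intervalIntegrable; fun_prop)
      (by apply Continuous.intervalIntegrable; fun_prop), hC,
      ← intervalIntegral.integral_const_mul]
    have hgint :
        IntervalIntegrable (fun t => δ * |lengthDensity gen t|) MeasureTheory.volume 0 1 := by
      apply Continuous.intervalIntegrable
      fun_prop
    rw [← Real.norm_eq_abs]
    refine intervalIntegral.norm_integral_le_of_norm_le zero_le_one
      (Eventually.of_forall fun t ht => ?_) hgint
    rw [← sub_mul, norm_mul]
    exact mul_le_mul_of_nonneg_right (hP t (Set.Ioc_subset_Icc_self ht)).le (norm_nonneg _)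
  filter_upwards [Metric.tendsto_nhds.1 (tendsto_lengthMean_polynomial hk hpos hmono hgcd P) δ hδ,
    eventually_gt_atTop 0, eventually_card_pos (by omega) hpos hgcd] with n h1 hn hc
  have hc0 : (0 : ℝ) < (factorizations gen n).card := by exact_mod_cast hc
  have hmean : |lengthMean gen f n - lengthMean gen (fun x => P.eval x) n| ≤ δ := by
    rw [lengthMean, lengthMean, ← sub_div, ← Finset.sum_sub_distrib, abs_div, abs_of_pos hc0,
      div_le_iff₀ hc0]
    refine (Finset.abs_sum_le_sum_abs _ _).trans ?_
    rw [mul_comm, ← nsmul_eq_mul]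
    refine Finset.sum_le_card_nsmul _ _ _ fun a ha => ?_
    rw [abs_sub_comm]
    exact (hP _ (Set.Ioc_subset_Icc_self
      (Icc_inv_subset_Ioc hk hpos (length_div_mem_Icc hk hpos hmono hn ha)))).le
  rw [Real.dist_eq] at h1 ⊢
  have hε' : δ * C + 2 * δ = ε := by rw [hδdef]; field_simp
  calc |lengthMean gen f n - ∫ t in (0 : ℝ)..1, f t * lengthDensity gen t|
      = |(lengthMean gen f n - lengthMean gen (fun x => P.eval x) n) +
          (lengthMean gen (fun x => P.eval x) n -
            ∫ t in (0 : ℝ)..1, P.eval t * lengthDensity gen t) +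
          ((∫ t in (0 : ℝ)..1, P.eval t * lengthDensity gen t) -
            ∫ t in (0 : ℝ)..1, f t * lengthDensity gen t)| := by congr 1; ring
    _ ≤ _ := abs_add_three _ _ _
    _ < ε := by linarith

theorem card_lengthMultiset {k : ℕ} (gen : Fin k → ℕ) (n : ℕ) :
    (lengthMultiset gen n).card = (factorizations gen n).card := by
  simp [lengthMultiset]

theorem tendsto_complex_average {k : ℕ} (hk : 3 ≤ k) {gen : Fin k → ℕ} (hpos : ∀ i, 0 < gen i)
    (hmono : StrictMono gen) (hgcd : Finset.univ.gcd gen = 1) {g : ℝ → ℂ}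
    (hg : ContinuousOn g
      (Set.Icc (1 / (gen ⟨k - 1, Nat.sub_one_lt_of_lt hk⟩ : ℝ))
        (1 / (gen ⟨0, Nat.zero_lt_of_lt hk⟩ : ℝ)))) :
    IntervalIntegrable (fun t => g t * (lengthDensity gen t : ℂ)) MeasureTheory.volume 0 1 ∧
      Tendsto
        (fun n : ℕ =>
          (1 / ((lengthMultiset gen n).card : ℂ)) *
            ((lengthMultiset gen n).map fun ℓ : ℕ => g ((ℓ : ℝ) / (n : ℝ))).sum)
        atTop (𝓝 (∫ t in (0 : ℝ)..1, g t * (lengthDensity gen t : ℂ))) := by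
  set A : ℝ := 1 / (gen ⟨k - 1, Nat.sub_one_lt_of_lt hk⟩ : ℝ) with hA
  set B : ℝ := 1 / (gen ⟨0, Nat.zero_lt_of_lt hk⟩ : ℝ) with hB
  have hF := continuous_lengthDensity gen
  have hAB : A ≤ B := by
    refine one_div_le_one_div_of_le (by exact_mod_cast hpos _) ?_
    exact_mod_cast hmono.monotone (Fin.le_def.2 (by simp))
  -- only the values of `g` on `[A, B]` matter, so `g` may be replaced by a continuous extension
  set G : ℝ → ℂ := Set.IccExtend hAB (Set.domRestrict (Set.Icc A B) g) with hGdef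
  have hG : Continuous G := (continuousOn_iff_continuous_domRestrict.1 hg).Icc_extend'
  have hGg : ∀ x ∈ Set.Icc A B, G x = g x := fun x hx => by
    rw [hGdef, Set.IccExtend_of_mem _ _ hx]; rfl
  have hfun : (fun t => g t * (lengthDensity gen t : ℂ)) =
      fun t => G t * (lengthDensity gen t : ℂ) := by
    funext t
    by_cases ht : t ∈ Set.Icc A B
    · rw [hGg t ht]
    · rw [lengthDensity_eq_zero hk hpos hmono ht]; simp
  rw [hfun]
  refine ⟨by apply Continuous.intervalIntegrable; fun_prop, ?_⟩
  have hre := tendsto_lengthMean hk hpos hmono hgcd (f := fun x => (G x).re) (by fun_prop)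
  have him := tendsto_lengthMean hk hpos hmono hgcd (f := fun x => (G x).im) (by fun_prop)
  have hlim := ((Complex.continuous_ofReal.tendsto _).comp hre).add
    (((Complex.continuous_ofReal.tendsto _).comp him).mul_const Complex.I)
  have hint : ∫ t in (0 : ℝ)..1, G t * (lengthDensity gen t : ℂ) =
      ((∫ t in (0 : ℝ)..1, (G t).re * lengthDensity gen t : ℝ) : ℂ) +
        ((∫ t in (0 : ℝ)..1, (G t).im * lengthDensity gen t : ℝ) : ℂ) * Complex.I := by
    rw [← intervalIntegral.integral_ofReal, ← intervalIntegral.integral_ofReal,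
      ← intervalIntegral.integral_mul_const, ← intervalIntegral.integral_add
        (by apply Continuous.intervalIntegrable; fun_prop)
        (by apply Continuous.intervalIntegrable; fun_prop)]
    refine intervalIntegral.integral_congr fun t _ => ?_
    nth_rw 1 [← Complex.re_add_im (G t)]
    push_cast
    ring
  rw [hint]
  refine hlim.congr' ?_
  filter_upwards [eventually_gt_atTop 0] with n hn
  have hsum : ((lengthMultiset gen n).map fun ℓ : ℕ => g ((ℓ : ℝ) / (n : ℝ))).sum =
      ∑ a ∈ factorizations gen n, G (((∑ i, a i : ℕ) : ℝ) / n) := by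
    rw [lengthMultiset, Multiset.map_map]
    exact Finset.sum_congr rfl fun a ha =>
      (hGg _ (length_div_mem_Icc hk hpos hmono hn ha)).symm
  rw [hsum, card_lengthMultiset]
  simp only [Function.comp, lengthMean]
  push_cast
  rw [div_mul_eq_mul_div, ← add_div, Finset.sum_mul, ← Finset.sum_add_distrib, one_div,
    inv_mul_eq_div]
  congr 1
  refine Finset.sum_congr rfl fun a _ => ?_
  rw [Complex.re_add_im]

/-! ### The density is a probability density -/

theorem lengthDensity_nonneg {k : ℕ} (hk : 3 ≤ k) {gen : Fin k → ℕ} (hpos : ∀ i, 0 < gen i)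
    (hmono : StrictMono gen) (hgcd : Finset.univ.gcd gen = 1) (x : ℝ) :
    0 ≤ lengthDensity gen x := by
  by_contra! hx
  have hF := continuous_lengthDensity gen
  have hmem : x ∈ Set.Ioc (0 : ℝ) 1 := by
    refine Icc_inv_subset_Ioc hk hpos ?_
    by_contra h
    exact hx.ne (lengthDensity_eq_zero hk hpos hmono h)
  -- test the limit of averages on the negative part of the density
  have h1 := tendsto_lengthMean hk hpos hmono hgcd (f := fun t => max (-lengthDensity gen t) 0)
    (by fun_prop)
  have h2 : 0 ≤ ∫ t in (0 : ℝ)..1, max (-lengthDensity gen t) 0 * lengthDensity gen t :=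
    ge_of_tendsto' h1 fun n =>
      div_nonneg (Finset.sum_nonneg fun a _ => le_max_right _ _) (Nat.cast_nonneg _)
  have h3 : ∀ t, max (-lengthDensity gen t) 0 * lengthDensity gen t =
      -(max (-lengthDensity gen t) 0 ^ 2) := by
    intro t
    rcases le_total (lengthDensity gen t) 0 with h | h
    · rw [max_eq_left (by linarith)]; ring
    · rw [max_eq_right (by linarith)]; ring
  simp only [h3] at h2
  have h4 : 0 < ∫ t in (0 : ℝ)..1, max (-lengthDensity gen t) 0 ^ 2 := by
    refine intervalIntegral.integral_pos zero_lt_one (by fun_prop) (fun _ _ => by positivity)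
      ⟨x, Set.Ioc_subset_Icc_self hmem, ?_⟩
    have : 0 < max (-lengthDensity gen x) 0 := lt_max_of_lt_left (by linarith)
    positivity
  rw [intervalIntegral.integral_neg] at h2
  linarith

theorem support_mul_lengthDensity_subset {k : ℕ} (hk : 3 ≤ k) {gen : Fin k → ℕ}
    (hpos : ∀ i, 0 < gen i) (hmono : StrictMono gen) (f : ℝ → ℝ) :
    (Function.support fun t => f t * lengthDensity gen t) ⊆ Set.Ioc 0 1 := by
  intro t ht
  refine Icc_inv_subset_Ioc hk hpos ?_
  by_contra h
  exact ht (by simp [lengthDensity_eq_zero hk hpos hmono h])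

theorem integrable_mul_lengthDensity {k : ℕ} (hk : 3 ≤ k) {gen : Fin k → ℕ}
    (hpos : ∀ i, 0 < gen i) (hmono : StrictMono gen) {f : ℝ → ℝ} (hf : Continuous f) :
    MeasureTheory.Integrable fun t => f t * lengthDensity gen t := by
  have hF := continuous_lengthDensity gen
  refine Continuous.integrable_of_hasCompactSupport (by fun_prop) ?_
  exact HasCompactSupport.of_support_subset_isCompact isCompact_Icc
    ((support_mul_lengthDensity_subset hk hpos hmono f).trans Set.Ioc_subset_Icc_self)

theorem integral_mul_lengthDensity_eq {k : ℕ} (hk : 3 ≤ k) {gen : Fin k → ℕ}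
    (hpos : ∀ i, 0 < gen i) (hmono : StrictMono gen) (f : ℝ → ℝ) :
    ∫ t in (0 : ℝ)..1, f t * lengthDensity gen t = ∫ t, f t * lengthDensity gen t :=
  intervalIntegral.integral_eq_integral_of_support_subset
    (support_mul_lengthDensity_subset hk hpos hmono f)

theorem integrable_lengthDensity {k : ℕ} (hk : 3 ≤ k) {gen : Fin k → ℕ} (hpos : ∀ i, 0 < gen i)
    (hmono : StrictMono gen) : MeasureTheory.Integrable (lengthDensity gen) := by
  simpa using integrable_mul_lengthDensity hk hpos hmono (f := fun _ => 1) continuous_const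

theorem integral_lengthDensity {k : ℕ} (hk : 3 ≤ k) {gen : Fin k → ℕ} (hpos : ∀ i, 0 < gen i)
    (hmono : StrictMono gen) : ∫ x, lengthDensity gen x = 1 := by
  have h := integral_pow_mul_lengthDensity hk hpos hmono.injective 0
  simp only [pow_zero] at h
  rw [integral_mul_lengthDensity_eq hk hpos hmono] at h
  simpa [MvPolynomial.hsymm_zero] using h

/-- Between two knots the density is a combination of the powers `(1 - nᵣ x) ^ (k - 2)` with
`nᵣ x < 1`. At most `k - 1` indices occur, so these powers are linearly independent and the density
cannot vanish near a point of the open interval. -/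
theorem tsupport_lengthDensity {k : ℕ} (hk : 3 ≤ k) {gen : Fin k → ℕ} (hpos : ∀ i, 0 < gen i)
    (hmono : StrictMono gen) :
    tsupport (lengthDensity gen) =
      Set.Icc (1 / (gen ⟨k - 1, Nat.sub_one_lt_of_lt hk⟩ : ℝ))
        (1 / (gen ⟨0, Nat.zero_lt_of_lt hk⟩ : ℝ)) := by
  have hpos' : ∀ i, (0 : ℝ) < gen i := fun i => by exact_mod_cast hpos i
  set A : ℝ := 1 / (gen ⟨k - 1, Nat.sub_one_lt_of_lt hk⟩ : ℝ) with hA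
  set B : ℝ := 1 / (gen ⟨0, Nat.zero_lt_of_lt hk⟩ : ℝ) with hB
  have hAB : A < B := by
    refine one_div_lt_one_div_of_lt (hpos' _) ?_
    exact_mod_cast hmono (Fin.lt_def.2 (by simp; omega))
  refine Set.Subset.antisymm (closure_minimal (fun x hx => ?_) isClosed_Icc) fun x hx => ?_
  · by_contra h
    exact hx (lengthDensity_eq_zero hk hpos hmono h)
  · by_contra hx'
    rw [notMem_tsupport_iff_eventuallyEq] at hx'
    obtain ⟨U, hU, hUo, hxU⟩ := eventually_nhds_iff.1 hx'
    -- a point `z` near `x` in the open interval, which is not a knot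
    obtain ⟨z, ⟨hzU, hzI⟩, hzk⟩ : ∃ z, z ∈ U ∩ Set.Ioo A B ∧
        z ∉ Set.range fun r => 1 / (gen r : ℝ) := by
      have hne : (U ∩ Set.Ioo A B).Nonempty := by
        rw [← closure_Ioo hAB.ne] at hx
        exact mem_closure_iff.1 hx U hUo hxU
      have hinf : (U ∩ Set.Ioo A B).Infinite := by
        obtain ⟨w, hw⟩ := hne
        exact infinite_of_mem_nhds w ((hUo.inter isOpen_Ioo).mem_nhds hw)
      exact hinf.exists_notMem_finite (Set.finite_range _)
    set S : Finset (Fin k) := Finset.univ.filter fun r => (gen r : ℝ) * z < 1 with hS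
    have hS0 : (⟨0, Nat.zero_lt_of_lt hk⟩ : Fin k) ∈ S := by
      have := (lt_div_iff₀' (hpos' _)).1 hzI.2
      simpa [hS] using this
    have hScard : S.card ≤ k - 1 := by
      have hlast : (⟨k - 1, Nat.sub_one_lt_of_lt hk⟩ : Fin k) ∉ S := by
        have := (div_lt_iff₀' (hpos' _)).1 hzI.1
        simpa [hS] using this.le
      have h := Finset.card_lt_univ_of_notMem hlast
      rw [Fintype.card_fin] at h
      omega
    set T : Polynomial ℝ := ∑ r ∈ S, Polynomial.C (1 / nodeProd gen r) *
      ((1 + Polynomial.X) ^ (k - 2)).comp (Polynomial.C (-(gen r : ℝ)) * Polynomial.X) with hT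
    have hc : ((k : ℝ) - 1) * (∏ i, (gen i : ℝ)) ≠ 0 := by
      have h1 : (3 : ℝ) ≤ k := by exact_mod_cast hk
      have h2 : 0 < ∏ i, (gen i : ℝ) := Finset.prod_pos fun i _ => hpos' i
      have h3 : (0 : ℝ) < k - 1 := by linarith
      positivity
    have hTroot : ∀ᶠ t in 𝓝 z, T.IsRoot t := by
      have hsign : ∀ᶠ t in 𝓝 z, ∀ r, (gen r : ℝ) * t < 1 ↔ r ∈ S := by
        rw [eventually_all]
        intro r
        have hcont : Tendsto (fun t : ℝ => (gen r : ℝ) * t) (𝓝 z) (𝓝 (gen r * z)) :=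
          tendsto_id.const_mul _
        by_cases hr : (gen r : ℝ) * z < 1
        · filter_upwards [hcont.eventually_lt_const hr] with t ht
          simp [hS, hr, ht]
        · have hr' : 1 < (gen r : ℝ) * z := by
            refine lt_of_le_of_ne (not_lt.1 hr) fun h => hzk ⟨r, ?_⟩
            have := (hpos' r).ne'
            simp only
            rw [h]
            field_simp
          filter_upwards [hcont.eventually_const_lt hr'] with t ht
          exact iff_of_false ht.not_gt (by simpa [hS] using hr'.le)
      filter_upwards [hsign, hUo.mem_nhds hzU] with t ht htU
      have h0 := hU t htU
      rw [lengthDensity_eq hk hmono.injective, Pi.zero_apply, mul_eq_zero, or_iff_right hc] at h0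
      rw [Polynomial.IsRoot, ← h0, hT, Polynomial.eval_finsetSum]
      refine Finset.sum_subset_zero_on_sdiff (Finset.subset_univ _) (fun r hr => ?_)
        fun r hr => ?_
      · have h1 : 1 - gen r * t ≤ 0 := by
          have := (ht r).not.2 (Finset.mem_sdiff.1 hr).2
          linarith
        simp [max_eq_right h1, show k - 2 ≠ 0 by omega]
      · have h1 : 0 ≤ 1 - gen r * t := by linarith [(ht r).2 hr]
        rw [max_eq_left h1]
        simp
        ring
    have hT0 : T = 0 :=
      Polynomial.eq_zero_of_infinite_isRoot T (infinite_of_mem_nhds z hTroot)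
    have hpow : ∀ j ≤ k - 2, ∑ r ∈ S, 1 / nodeProd gen r * (-(gen r : ℝ)) ^ j = 0 := by
      intro j hj
      have h := congrArg (fun P => Polynomial.coeff P j) hT0
      simp only [hT, Polynomial.finsetSum_coeff, Polynomial.coeff_C_mul,
        Polynomial.comp_C_mul_X_coeff, Polynomial.coeff_one_add_X_pow, Polynomial.coeff_zero] at h
      have hch : ((k - 2).choose j : ℝ) ≠ 0 := by exact_mod_cast (Nat.choose_pos hj).ne'
      refine (mul_eq_zero_iff_left hch).1 ?_
      rw [← h, Finset.mul_sum]
      exact Finset.sum_congr rfl fun r _ => by ring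
    -- this polynomial vanishes at every node of `S` but the first
    set q : Polynomial ℝ := ∏ j ∈ S.erase ⟨0, Nat.zero_lt_of_lt hk⟩,
      (Polynomial.X - Polynomial.C (-(gen j : ℝ))) with hq
    have hqdeg : q.natDegree ≤ k - 2 := by
      rw [hq, Polynomial.natDegree_finsetProd_X_sub_C_eq_card, Finset.card_erase_of_mem hS0]
      omega
    have hsum0 : ∑ r ∈ S, 1 / nodeProd gen r * q.eval (-(gen r : ℝ)) = 0 := by
      simp only [Polynomial.eval_eq_sum_range, Finset.mul_sum]
      rw [Finset.sum_comm]
      refine Finset.sum_eq_zero fun j hj => ?_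
      have := hpow j (by rw [Finset.mem_range] at hj; omega)
      rw [← mul_zero (q.coeff j), ← this, Finset.mul_sum]
      exact Finset.sum_congr rfl fun r _ => by ring
    rw [Finset.sum_eq_single_of_mem _ hS0 fun r hr hr0 => ?_] at hsum0
    · refine mul_ne_zero (one_div_ne_zero (nodeProd_ne_zero hmono.injective _)) ?_ hsum0
      rw [hq, Polynomial.eval_prod]
      refine Finset.prod_ne_zero_iff.2 fun j hj => ?_
      simp only [Polynomial.eval_sub, Polynomial.eval_X, Polynomial.eval_C]
      rw [sub_ne_zero, Ne, neg_inj]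
      exact_mod_cast hmono.injective.ne (Finset.ne_of_mem_erase hj).symm
    · rw [hq, Polynomial.eval_prod, Finset.prod_eq_zero (Finset.mem_erase.2 ⟨hr0, hr⟩) (by simp),
        mul_zero]

/-! ### The asymptotic distribution of lengths -/

/-- A trapezoid of height `1` with plateau `[α + δ, β - δ]` and base `[α, β]`. -/
noncomputable def trapezoid (α β δ t : ℝ) : ℝ := max 0 (min 1 (min (t - α) (β - t) / δ))

theorem continuous_trapezoid (α β δ : ℝ) : Continuous (trapezoid α β δ) := by
  unfold trapezoid
  fun_prop

theorem trapezoid_le_indicator {α β δ : ℝ} (hδ : 0 < δ) (t : ℝ) :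
    trapezoid α β δ t ≤ (Set.Icc α β).indicator 1 t := by
  by_cases ht : t ∈ Set.Icc α β
  · rw [Set.indicator_of_mem ht]
    exact max_le zero_le_one (min_le_left _ _)
  · rw [Set.indicator_of_notMem ht]
    have h : min (t - α) (β - t) ≤ 0 := by
      by_contra! h
      rw [lt_min_iff] at h
      exact ht ⟨by linarith, by linarith⟩
    exact max_le le_rfl ((min_le_right _ _).trans (div_nonpos_of_nonpos_of_nonneg h hδ.le))

theorem indicator_le_trapezoid {α β δ : ℝ} (hδ : 0 < δ) (t : ℝ) :
    (Set.Icc α β).indicator 1 t ≤ trapezoid (α - δ) (β + δ) δ t := by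
  by_cases ht : t ∈ Set.Icc α β
  · rw [Set.indicator_of_mem ht]
    refine le_max_of_le_right (le_min le_rfl ?_)
    rw [Pi.one_apply, le_div_iff₀ hδ, one_mul, le_min_iff]
    exact ⟨by linarith [ht.1], by linarith [ht.2]⟩
  · rw [Set.indicator_of_notMem ht]
    exact le_max_left _ _

theorem integral_indicator_mul_lengthDensity {k : ℕ} (gen : Fin k → ℕ) {a b : ℝ} (hab : a ≤ b) :
    ∫ t, (Set.Icc a b).indicator 1 t * lengthDensity gen t = ∫ t in a..b, lengthDensity gen t := by
  rw [intervalIntegral.integral_of_le hab, ← MeasureTheory.integral_Icc_eq_integral_Ioc,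
    ← MeasureTheory.integral_indicator measurableSet_Icc]
  refine MeasureTheory.integral_congr_ae (Eventually.of_forall fun t => ?_)
  by_cases ht : t ∈ Set.Icc a b <;> simp [ht]

theorem tendsto_lengthMean_indicator {k : ℕ} (hk : 3 ≤ k) {gen : Fin k → ℕ}
    (hpos : ∀ i, 0 < gen i) (hmono : StrictMono gen) (hgcd : Finset.univ.gcd gen = 1) {α β : ℝ}
    (hαβ : α < β) :
    Tendsto (lengthMean gen ((Set.Icc α β).indicator 1)) atTop
      (𝓝 (∫ t in α..β, lengthDensity gen t)) := by
  have hF := continuous_lengthDensity gen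
  have hint : ∀ a b, IntervalIntegrable (lengthDensity gen) MeasureTheory.volume a b :=
    fun a b => hF.intervalIntegrable a b
  have hindint : ∀ a b : ℝ, MeasureTheory.Integrable fun t =>
      (Set.Icc a b).indicator 1 t * lengthDensity gen t := by
    intro a b
    have := (integrable_lengthDensity hk hpos hmono).indicator (measurableSet_Icc (a := a) (b := b))
    refine this.congr (Eventually.of_forall fun t => ?_)
    by_cases ht : t ∈ Set.Icc a b <;> simp [ht]
  have hcont : Continuous fun δ : ℝ => ∫ t in (α - δ)..(β + δ), lengthDensity gen t := by
    have hprim : Continuous fun x : ℝ => ∫ t in (0 : ℝ)..x, lengthDensity gen t :=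
      intervalIntegral.continuous_primitive hint 0
    have h : (fun δ : ℝ => ∫ t in (α - δ)..(β + δ), lengthDensity gen t) = fun δ =>
        (∫ t in (0 : ℝ)..(β + δ), lengthDensity gen t) -
          ∫ t in (0 : ℝ)..(α - δ), lengthDensity gen t := by
      funext δ
      rw [intervalIntegral.integral_interval_sub_left (hint _ _) (hint _ _)]
    rw [h]
    exact (hprim.comp (by fun_prop)).sub (hprim.comp (by fun_prop))
  have hnear : Tendsto (fun δ : ℝ => ∫ t in (α - δ)..(β + δ), lengthDensity gen t) (𝓝 0)
      (𝓝 (∫ t in α..β, lengthDensity gen t)) := by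
    simpa using hcont.tendsto 0
  refine tendsto_order.2 ⟨fun c hc => ?_, fun c hc => ?_⟩
  · have hev := hnear.eventually_const_lt hc
    have hev' : ∀ᶠ δ : ℝ in 𝓝 0, c < ∫ t in (α + δ)..(β - δ), lengthDensity gen t := by
      have h := (continuous_neg.tendsto' (0 : ℝ) 0 neg_zero).eventually hev
      simpa [sub_neg_eq_add, ← sub_eq_add_neg] using h
    obtain ⟨δ, ⟨hδ, hδc⟩, hδ'⟩ := ((eventually_mem_nhdsWithin (s := Set.Ioi (0 : ℝ))).and
      (nhdsWithin_le_nhds hev')).and (nhdsWithin_le_nhds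
        (eventually_lt_nhds (show (0 : ℝ) < (β - α) / 2 by linarith))) |>.exists
    replace hδ : 0 < δ := hδ
    have hlim := tendsto_lengthMean hk hpos hmono hgcd (continuous_trapezoid α β δ)
    have hle : c < ∫ t in (0 : ℝ)..1, trapezoid α β δ t * lengthDensity gen t := by
      refine hδc.trans_le ?_
      rw [integral_mul_lengthDensity_eq hk hpos hmono,
        ← integral_indicator_mul_lengthDensity gen (by linarith)]
      refine MeasureTheory.integral_mono (hindint _ _)
        (integrable_mul_lengthDensity hk hpos hmono (continuous_trapezoid α β δ)) fun t => ?_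
      have h := indicator_le_trapezoid (α := α + δ) (β := β - δ) hδ t
      rw [add_sub_cancel_right, sub_add_cancel] at h
      exact mul_le_mul_of_nonneg_right h (lengthDensity_nonneg hk hpos hmono hgcd t)
    filter_upwards [hlim.eventually_const_lt hle] with n hn
    exact hn.trans_le (lengthMean_mono (trapezoid_le_indicator hδ) n)
  · obtain ⟨δ, hδ, hδc⟩ := ((eventually_mem_nhdsWithin (s := Set.Ioi (0 : ℝ))).and
      (nhdsWithin_le_nhds (hnear.eventually_lt_const hc))).exists
    replace hδ : 0 < δ := hδ
    have hlim := tendsto_lengthMean hk hpos hmono hgcd (continuous_trapezoid (α - δ) (β + δ) δ)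
    have hle : ∫ t in (0 : ℝ)..1, trapezoid (α - δ) (β + δ) δ t * lengthDensity gen t < c := by
      refine lt_of_le_of_lt ?_ hδc
      rw [integral_mul_lengthDensity_eq hk hpos hmono,
        ← integral_indicator_mul_lengthDensity gen (by linarith)]
      refine MeasureTheory.integral_mono
        (integrable_mul_lengthDensity hk hpos hmono (continuous_trapezoid _ _ δ)) (hindint _ _)
        fun t => ?_
      exact mul_le_mul_of_nonneg_right (trapezoid_le_indicator hδ t)
        (lengthDensity_nonneg hk hpos hmono hgcd t)
    filter_upwards [hlim.eventually_lt_const hle] with n hn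
    exact (lengthMean_mono (indicator_le_trapezoid hδ) n).trans_lt hn

theorem card_filter_div_card_eq_lengthMean {k : ℕ} (gen : Fin k → ℕ) (α β : ℝ) {n : ℕ}
    (hn : 0 < n) :
    (((lengthMultiset gen n).filter
        fun ℓ : ℕ => (ℓ : ℝ) ∈ Set.Icc (α * n) (β * n)).card : ℝ) /
      ((lengthMultiset gen n).card : ℝ) = lengthMean gen ((Set.Icc α β).indicator 1) n := by
  classical
  have hn0 : (0 : ℝ) < n := by exact_mod_cast hn
  have hmem : ∀ ℓ : ℕ, (ℓ : ℝ) ∈ Set.Icc (α * n) (β * n) ↔ (ℓ : ℝ) / n ∈ Set.Icc α β := by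
    intro ℓ
    rw [Set.mem_Icc, Set.mem_Icc, le_div_iff₀ hn0, div_le_iff₀ hn0]
  rw [card_lengthMultiset, lengthMean]
  congr 1
  simp only [Set.indicator_apply, Pi.one_apply, ← hmem]
  rw [Finset.sum_boole, lengthMultiset, Multiset.filter_map, Multiset.card_map]
  rfl

theorem theorem1 (k : ℕ) (hk : 3 ≤ k) (gen : Fin k → ℕ) (hpos : ∀ i, 0 < gen i)
    (hmono : StrictMono gen) (hgcd : Finset.univ.gcd gen = 1) :
    -- `F` is a probability density function with support `[1/n_k, 1/n_1]`
    ((∀ x, 0 ≤ lengthDensity gen x) ∧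
      MeasureTheory.Integrable (lengthDensity gen) ∧
      ∫ x, lengthDensity gen x = 1 ∧
      tsupport (lengthDensity gen) =
        Set.Icc (1 / (gen ⟨k - 1, by omega⟩ : ℝ)) (1 / (gen ⟨0, by omega⟩ : ℝ))) ∧
    -- asymptotic distribution of the factorization lengths
    (∀ α β : ℝ, α < β →
      Tendsto
        (fun n : ℕ =>
          (((lengthMultiset gen n).filter
              fun ℓ : ℕ => (ℓ : ℝ) ∈ Set.Icc (α * n) (β * n)).card : ℝ) /
            ((lengthMultiset gen n).card : ℝ))
        atTop (𝓝 (∫ t in α..β, lengthDensity gen t))) ∧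
    -- moments
    (∀ p : ℕ,
      ∫ t in (0 : ℝ)..1, t ^ p * lengthDensity gen t =
        ((p + k - 1).choose p : ℝ)⁻¹ *
          MvPolynomial.eval (fun i => 1 / (gen i : ℝ)) (MvPolynomial.hsymm (Fin k) ℝ p)) ∧
    -- averages of continuous functions
    (∀ g : ℝ → ℂ,
      ContinuousOn g
        (Set.Icc (1 / (gen ⟨k - 1, by omega⟩ : ℝ)) (1 / (gen ⟨0, by omega⟩ : ℝ))) →
      IntervalIntegrable (fun t => g t * (lengthDensity gen t : ℂ)) MeasureTheory.volume 0 1 ∧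
      Tendsto
        (fun n : ℕ =>
          (1 / ((lengthMultiset gen n).card : ℂ)) *
            ((lengthMultiset gen n).map fun ℓ : ℕ => g ((ℓ : ℝ) / (n : ℝ))).sum)
        atTop (𝓝 (∫ t in (0 : ℝ)..1, g t * (lengthDensity gen t : ℂ)))) := by
  refine ⟨⟨lengthDensity_nonneg hk hpos hmono hgcd, integrable_lengthDensity hk hpos hmono,
    integral_lengthDensity hk hpos hmono, tsupport_lengthDensity hk hpos hmono⟩,
    fun α β hαβ => ?_, integral_pow_mul_lengthDensity hk hpos hmono.injective,
    fun g hg => tendsto_complex_average hk hpos hmono hgcd hg⟩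
  refine (tendsto_lengthMean_indicator hk hpos hmono hgcd hαβ).congr' ?_
  filter_upwards [eventually_gt_atTop 0] with n hn
  exact (card_filter_div_card_eq_lengthMean gen α β hn).symm
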